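/- Let $m\ge 2$. For $d\ge 1$ let $S^d\subset\mathbb R^{d+1}$ be the unit sphere and let $\cdot$ be the usual inner product. Let $P_k^d$ ($k=0,1,\dots$) be the Gegenbauer polynomial of degree $k$ with parameter $(d-1)/2$, normalized for $d\ge 2$ by $P_k^d(1)=\binom{k+d-2}{k}$ and for $d=1$ by $P_0^1=1$ and $P_k^1(\cos\theta)=\frac2k\cos k\theta$ for $k\ge1$. A real kernel $K$ on a nonempty set $X$ is positive definite if $K(x,y)=K(y,x)$ for all $x,y\in X$ and $\sum_{\mu,\nu=1}^n c_\mu c_\nu K(x_\mu,x_\nu)\ge 0$ for all $n\ge 1$, all distinct $x_1,\dots,x_n\in X$ and all real $c_1,\dots,c_n$. It is strictly positive definite if moreover this sum is positive whenever some $c_\mu$ is nonzero. For $I\subseteq\{0,1,2,\dots\}$ write $I\in\mathrm{SPD}(S^d)$ if there is a continuous $g:[-1,1]\to\mathbb R$ such that the kernel $(z,w)\mapsto g(z\cdot w)$ is strictly positive definite on $S^d$ and $g(t)=\sum_{l\ge 0} b_l P_l^d(t)$ for $t\in[-1,1]$, with $b_l\ge 0$, $\sum_l b_lP_l^d(1)<\infty$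 and $\{l: b_l>0\}=I$. Let $f:[-1,1]^2\to\mathbb R$ be continuous and such that the kernel $((x,z),(y,w))\mapsto f(x\cdot y,z\cdot w)$ is positive definite on $S^1\times S^m$, and consider its series representation $$f(t,s)=\sum_{k,l=0}^\infty a_{k,l}^{1,m}P_k^1(t)P_l^m(s),\qquad t,s\in[-1,1],$$ where $a_{k,l}^{1,m}\ge 0$ and $\sum_{k,l}a_{k,l}^{1,m}P_k^1(1)P_l^m(1)<\infty$. Theorem. If $$\big\{l:\{k: a_{k,l}^{1,m}>0\}\in\mathrm{SPD}(S^1)\big\}\in\mathrm{SPD}(S^m),$$ then the kernel $((x,z),(y,w))\mapsto f(x\cdot y,z\cdot w)$ is strictly positive definite on $S^1\times S^m$. -/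

import Mathlib

namespace SphereKernel

open Polynomial

/-- The unit sphere `S^m` of `ℝ^(m+1)`. -/
abbrev Sph (m : ℕ) : Type := Metric.sphere (0 : EuclideanSpace ℝ (Fin (m + 1))) 1

/-- A real kernel is positive definite: it is symmetric, and its quadratic form at any finite
family of distinct points is nonnegative. -/
def IsPosDefKernel {X : Type*} (K : X → X → ℝ) : Prop :=
  (∀ x y, K x y = K y x) ∧
    ∀ (n : ℕ) (x : Fin n → X), Function.Injective x → ∀ c : Fin n → ℝ,
      0 ≤ ∑ i, ∑ j, c i * c j * K (x i) (x j)

/-- A real kernel is strictly positive definite: it is positive definite, and its quadratic form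
at any finite family of distinct points is positive as soon as some scalar is nonzero. -/
def IsStrictPosDefKernel {X : Type*} (K : X → X → ℝ) : Prop :=
  IsPosDefKernel K ∧
    ∀ (n : ℕ) (x : Fin n → X), Function.Injective x → ∀ c : Fin n → ℝ, c ≠ 0 →
      0 < ∑ i, ∑ j, c i * c j * K (x i) (x j)

/-- The kernel `(x, y) ↦ g (x · y)` on `S^m`. -/
noncomputable def isoKernel (m : ℕ) (g : ℝ → ℝ) (x y : Sph m) : ℝ :=
  g (inner ℝ (x : EuclideanSpace ℝ (Fin (m + 1))) (y : EuclideanSpace ℝ (Fin (m + 1))))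

/-- The kernel `((x, z), (y, w)) ↦ f (x · y, z · w)` on `S^m × S^M`. -/
noncomputable def isoKernelProd (m M : ℕ) (f : ℝ → ℝ → ℝ) (p q : Sph m × Sph M) : ℝ :=
  f (inner ℝ (p.1 : EuclideanSpace ℝ (Fin (m + 1))) (q.1 : EuclideanSpace ℝ (Fin (m + 1))))
    (inner ℝ (p.2 : EuclideanSpace ℝ (Fin (M + 1))) (q.2 : EuclideanSpace ℝ (Fin (M + 1))))

/-- The classical Gegenbauer polynomials `C_n^lam`, by the three-term recurrence
`(n + 2) C_{n+2} = 2 (n + 1 + lam) X C_{n+1} - (n + 2 lam) C_n`. -/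
noncomputable def gegenbauer (lam : ℝ) : ℕ → ℝ[X]
  | 0 => 1
  | 1 => C (2 * lam) * X
  | n + 2 => C (2 * ((n : ℝ) + 1 + lam) / ((n : ℝ) + 2)) * X * gegenbauer lam (n + 1)
      - C (((n : ℝ) + 2 * lam) / ((n : ℝ) + 2)) * gegenbauer lam n

/-- The polynomials `P_k^m` attached to the sphere `S^m`, for `m ≥ 1`: for `m ≥ 2` the Gegenbauer
polynomials for the parameter `(m - 1) / 2`, with `P_k^m(1) = (k + m - 2).choose k`; for `m = 1`
the limiting case `P_0^1 = 1` and `P_k^1(cos θ) = (2 / k) cos (k θ)` for `k ≥ 1`. -/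
noncomputable def P (m k : ℕ) : ℝ[X] :=
  if m = 1 then
    if k = 0 then 1 else C (2 / (k : ℝ)) * Chebyshev.T ℝ (k : ℤ)
  else gegenbauer (((m : ℝ) - 1) / 2) k

/-- `b` is the coefficient sequence of a Schoenberg series representation of `g` on `[-1, 1]`:
`g(t) = ∑ b_k P_k^m(t)` with `b_k ≥ 0` and `∑ b_k P_k^m(1) < ∞`. -/
def IsSchoenbergSeries (m : ℕ) (g : ℝ → ℝ) (b : ℕ → ℝ) : Prop :=
  (∀ k, 0 ≤ b k) ∧ (Summable fun k => b k * (P m k).eval 1) ∧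
    ∀ t ∈ Set.Icc (-1 : ℝ) 1, HasSum (fun k => b k * (P m k).eval t) (g t)

/-- `a` is the coefficient family of a double series representation of `f` on `[-1, 1]²`:
`f(t, s) = ∑ a_{k,l} P_k^m(t) P_l^M(s)` with `a_{k,l} ≥ 0` and
`∑ a_{k,l} P_k^m(1) P_l^M(1) < ∞`. -/
def IsDoubleSchoenbergSeries (m M : ℕ) (f : ℝ → ℝ → ℝ) (a : ℕ → ℕ → ℝ) : Prop :=
  (∀ k l, 0 ≤ a k l) ∧
    (Summable fun p : ℕ × ℕ => a p.1 p.2 * (P m p.1).eval 1 * (P M p.2).eval 1) ∧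
    ∀ t ∈ Set.Icc (-1 : ℝ) 1, ∀ s ∈ Set.Icc (-1 : ℝ) 1,
      HasSum (fun p : ℕ × ℕ => a p.1 p.2 * (P m p.1).eval t * (P M p.2).eval s) (f t s)

/-- `SPD m` is the collection of the sets `I ⊆ ℕ` such that some continuous, isotropic and
strictly positive definite kernel `g (z · w)` on `S^m` has `{l | 0 < b_l} = I`, where `b_l` are
the coefficients in the series representation of `g`. -/
def SPD (m : ℕ) : Set (Set ℕ) :=
  {I | ∃ (g : ℝ → ℝ) (b : ℕ → ℝ), ContinuousOn g (Set.Icc (-1) 1) ∧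
    IsSchoenbergSeries m g b ∧ IsStrictPosDefKernel (isoKernel m g) ∧ {l | 0 < b l} = I}

end SphereKernel

/-! Suppose the quadratic form vanishes at distinct points `(x_i, z_i)` with scalars `c_i`. Its
series has nonnegative terms, so the form of every `P_k ⊗ P_l` with `a k l > 0` vanishes
(`form_prod_eq_zero`). Fix `l` whose set of `k` lies in `SPD 1`. Factoring the Gram matrix of `P_l`
as a sum of `v_r v_rᵀ` and summing over `k` with the weights of a strict kernel on the circle forces
the sums of `c_i v_r(i)` over each fibre `x_i = ξ` to vanish, hence also the `P_l` form on that
fibre (`fiber_form_eq_zero`). On one fibre the `z_i` are distinct, so a strict kernel on `S^m` with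
these `l` gives `c = 0` (`eq_zero_of_fiber_form_eq_zero`).

The termwise sign needs Gegenbauer kernels to be positive definite (`gegenbauer_form_nonneg`): up to
a positive factor they are Gram kernels of harmonic zonal polynomials for the Fischer inner product.
-/

namespace SphereKernel

open MvPolynomial Finset

/-! ### Fischer inner product and differential operators. -/

section Fischer

variable {σ : Type*} [Fintype σ]

/-- The multi-index factorial. -/
def multiFactorial (s : σ →₀ ℕ) : ℝ := ∏ i, ((s i).factorial : ℝ)

lemma multiFactorial_pos (s : σ →₀ ℕ) : 0 < multiFactorial s :=
  Finset.prod_pos fun _ _ => by positivity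

lemma multiFactorial_add_single (s : σ →₀ ℕ) (i : σ) :
    multiFactorial (s + Finsupp.single i 1) = multiFactorial s * ((s i : ℝ) + 1) := by
  classical
  unfold multiFactorial
  rw [Fintype.prod_eq_mul_prod_compl i, Fintype.prod_eq_mul_prod_compl i (fun j => ((s j).factorial : ℝ))]
  have h : ∏ j ∈ ({i} : Finset σ)ᶜ, (((s + Finsupp.single i 1 : σ →₀ ℕ) j).factorial : ℝ)
      = ∏ j ∈ ({i} : Finset σ)ᶜ, ((s j).factorial : ℝ) := by
    refine Finset.prod_congr rfl fun j hj => ?_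
    have : j ≠ i := by simpa using hj
    simp [this.symm]
  rw [h]
  simp only [Finsupp.coe_add, Pi.add_apply, Finsupp.single_eq_same, Nat.factorial_succ]
  push_cast
  ring

/-- The Fischer inner product of real polynomials, `⟨p, q⟩ = ∑ s, s! p_s q_s`. -/
noncomputable def fischer : MvPolynomial σ ℝ →ₗ[ℝ] MvPolynomial σ ℝ →ₗ[ℝ] ℝ :=
  (basisMonomials σ ℝ).constr ℝ fun s => multiFactorial s • lcoeff ℝ s

lemma fischer_monomial (s : σ →₀ ℕ) (r : ℝ) (q : MvPolynomial σ ℝ) :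
    fischer (monomial s r) q = r * (multiFactorial s * coeff s q) := by
  have h : (monomial s r : MvPolynomial σ ℝ) = r • basisMonomials σ ℝ s := by
    simp [smul_monomial]
  rw [h, map_smul, fischer, Module.Basis.constr_basis]
  simp [lcoeff]

lemma fischer_self_nonneg (p : MvPolynomial σ ℝ) : 0 ≤ fischer p p := by
  have h : fischer p p = ∑ s ∈ p.support, coeff s p * (multiFactorial s * coeff s p) := by
    conv_lhs => enter [1, 2]; rw [p.as_sum]
    rw [map_sum, LinearMap.sum_apply]
    exact Finset.sum_congr rfl fun s _ => fischer_monomial _ _ _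
  rw [h]
  refine Finset.sum_nonneg fun s _ => ?_
  have := multiFactorial_pos s
  nlinarith [mul_nonneg this.le (mul_self_nonneg (coeff s p))]

/-- The weights `s!` are chosen for this adjointness: raising `s i` by one multiplies `s!` by `s i +
1`, the factor that differentiation produces. -/
lemma fischer_X_mul (i : σ) (p q : MvPolynomial σ ℝ) :
    fischer (X i * p) q = fischer p (pderiv i q) := by
  induction p using MvPolynomial.induction_on' with
  | add p p' hp hp' => simp only [mul_add, map_add, LinearMap.add_apply, hp, hp']
  | monomial s r =>
    rw [X, monomial_mul, one_mul, add_comm, fischer_monomial, fischer_monomial, coeff_pderiv,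
      multiFactorial_add_single]
    ring

/-- The linear form `x ↦ x · y`. -/
noncomputable def dotPoly (y : σ → ℝ) : MvPolynomial σ ℝ := ∑ i, C (y i) * X i

/-- The quadratic form `x ↦ x · x`. -/
noncomputable def normSqPoly : MvPolynomial σ ℝ := ∑ i, X i ^ 2

/-- The derivative in the direction `y`. -/
noncomputable def dirDeriv (y : σ → ℝ) :
    Derivation ℝ (MvPolynomial σ ℝ) (MvPolynomial σ ℝ) := ∑ i, y i • pderiv i

/-- The Laplacian. -/
noncomputable def laplacian : MvPolynomial σ ℝ →ₗ[ℝ] MvPolynomial σ ℝ :=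
  ∑ i, (pderiv i).toLinearMap ∘ₗ (pderiv i).toLinearMap

lemma dirDeriv_apply (y : σ → ℝ) (p : MvPolynomial σ ℝ) :
    dirDeriv y p = ∑ i, C (y i) * pderiv i p := by
  have h : (dirDeriv y : MvPolynomial σ ℝ → MvPolynomial σ ℝ) = ∑ i, ⇑(y i • pderiv (R := ℝ) i) :=
    map_sum Derivation.coeFnAddMonoidHom _ _
  rw [h, Finset.sum_apply]
  simp [C_mul']

lemma laplacian_apply (p : MvPolynomial σ ℝ) :
    laplacian p = ∑ i, pderiv i (pderiv i p) := by
  simp [laplacian]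

lemma fischer_dotPoly_mul (y : σ → ℝ) (p q : MvPolynomial σ ℝ) :
    fischer (dotPoly y * p) q = fischer p (dirDeriv y q) := by
  simp only [dotPoly, dirDeriv_apply, Finset.sum_mul, map_sum, LinearMap.sum_apply,
    C_mul', map_smul, LinearMap.smul_apply, smul_mul_assoc, fischer_X_mul]

/-- Consequently multiples of `normSqPoly` are orthogonal to harmonic polynomials. -/
lemma fischer_normSqPoly_mul (p q : MvPolynomial σ ℝ) :
    fischer (normSqPoly * p) q = fischer p (laplacian q) := by
  simp only [normSqPoly, laplacian_apply, Finset.sum_mul, map_sum, LinearMap.sum_apply, sq,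
    mul_assoc, fischer_X_mul]

lemma isHomogeneous_dirDeriv (y : σ → ℝ) {p : MvPolynomial σ ℝ} {n : ℕ}
    (hp : p.IsHomogeneous n) : (dirDeriv y p).IsHomogeneous (n - 1) := by
  rw [dirDeriv_apply]
  refine IsHomogeneous.sum _ _ _ fun i _ => ?_
  rw [C_mul']
  exact (homogeneousSubmodule σ ℝ (n - 1)).smul_mem _ hp.pderiv

lemma eval_dirDeriv_self (y : σ → ℝ) {p : MvPolynomial σ ℝ} {n : ℕ}
    (hp : p.IsHomogeneous n) : eval y (dirDeriv y p) = n * eval y p := by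
  have h := congrArg (eval y) hp.sum_X_mul_pderiv
  simpa [dirDeriv_apply] using h

/-- Powers of linear forms reproduce homogeneous polynomials. -/
lemma fischer_dotPoly_pow (y : σ → ℝ) (n : ℕ) :
    ∀ q : MvPolynomial σ ℝ, q.IsHomogeneous n →
      fischer (dotPoly y ^ n) q = n.factorial * eval y q := by
  induction n with
  | zero =>
    intro q hq
    rw [← totalDegree_zero_iff_isHomogeneous, totalDegree_eq_zero_iff_eq_C] at hq
    rw [hq, pow_zero, ← C_1, ← monomial_zero', fischer_monomial]
    simp [multiFactorial]
  | succ n ih =>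
    intro q hq
    rw [pow_succ', fischer_dotPoly_mul, ih _ (isHomogeneous_dirDeriv y hq),
      eval_dirDeriv_self y hq, Nat.factorial_succ]
    push_cast
    ring

lemma pderiv_dotPoly (y : σ → ℝ) (i : σ) : pderiv i (dotPoly y) = C (y i) := by
  classical
  simp [dotPoly, pderiv_X, Pi.single_apply, map_sum]

lemma pderiv_normSqPoly (i : σ) : pderiv i (normSqPoly : MvPolynomial σ ℝ) = 2 * X i := by
  classical
  simp [normSqPoly, pderiv_X, Pi.single_apply, map_sum]

lemma dirDeriv_dotPoly (y : σ → ℝ) : dirDeriv y (dotPoly y) = C (∑ i, y i ^ 2) := by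
  simp [dirDeriv_apply, pderiv_dotPoly, map_sum, sq]

lemma dirDeriv_normSqPoly (y : σ → ℝ) : dirDeriv y normSqPoly = 2 * dotPoly y := by
  simp only [dirDeriv_apply, pderiv_normSqPoly, dotPoly, Finset.mul_sum]
  exact Finset.sum_congr rfl fun i _ => by ring

lemma laplacian_dotPoly_mul (y : σ → ℝ) (p : MvPolynomial σ ℝ) :
    laplacian (dotPoly y * p) = 2 * dirDeriv y p + dotPoly y * laplacian p := by
  simp only [laplacian_apply, dirDeriv_apply, Finset.mul_sum, ← Finset.sum_add_distrib]
  refine Finset.sum_congr rfl fun i _ => ?_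
  simp only [pderiv_mul, map_add, pderiv_dotPoly, pderiv_C]
  ring

lemma laplacian_normSqPoly_mul {p : MvPolynomial σ ℝ} {n : ℕ} (hp : p.IsHomogeneous n) :
    laplacian (normSqPoly * p)
      = C (2 * (Fintype.card σ : ℝ) + 4 * n) * p + normSqPoly * laplacian p := by
  have h : ∀ i : σ, pderiv i (pderiv i (normSqPoly * p))
      = 2 * p + 4 * (X i * pderiv i p) + normSqPoly * pderiv i (pderiv i p) := by
    intro i
    have h2 : pderiv i (2 : MvPolynomial σ ℝ) = 0 := by
      rw [← map_ofNat C 2, pderiv_C]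
    simp only [pderiv_mul, map_add, pderiv_normSqPoly, pderiv_X_self, h2]
    ring
  simp only [laplacian_apply, h, Finset.sum_add_distrib, ← Finset.mul_sum, hp.sum_X_mul_pderiv,
    Finset.sum_const, Finset.card_univ]
  simp only [nsmul_eq_mul, C_add, C_mul, map_natCast, map_ofNat]
  ring

/-! ### Zonal polynomials and positivity of Gegenbauer kernels. -/

/-- The zonal polynomials: the homogenized Gegenbauer polynomials with unit pole `y`. -/
noncomputable def zonal (lam : ℝ) (y : σ → ℝ) : ℕ → MvPolynomial σ ℝ
  | 0 => 1
  | 1 => C (2 * lam) * dotPoly y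
  | n + 2 => C (2 * ((n : ℝ) + 1 + lam) / ((n : ℝ) + 2)) * (dotPoly y * zonal lam y (n + 1))
      - C (((n : ℝ) + 2 * lam) / ((n : ℝ) + 2)) * (normSqPoly * zonal lam y n)

lemma eval_zonal (lam : ℝ) (y x : σ → ℝ) (hx : ∑ i, x i ^ 2 = 1) (n : ℕ) :
    eval x (zonal lam y n) = (gegenbauer lam n).eval (∑ i, y i * x i) := by
  have hR : eval x (normSqPoly : MvPolynomial σ ℝ) = 1 := by simp [normSqPoly, hx]
  have hd : eval x (dotPoly y) = ∑ i, y i * x i := by simp [dotPoly]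
  induction n using Nat.twoStepInduction with
  | zero => simp [zonal, gegenbauer]
  | one => simp [zonal, gegenbauer, hd]
  | more n ih0 ih1 =>
    simp only [zonal, gegenbauer, map_sub, map_mul, eval_C, ih0, ih1, hR, hd, Polynomial.eval_sub,
      Polynomial.eval_mul, Polynomial.eval_C, Polynomial.eval_X]
    ring

lemma isHomogeneous_dotPoly (y : σ → ℝ) : (dotPoly y).IsHomogeneous 1 := by
  refine IsHomogeneous.sum _ _ _ fun i _ => ?_
  simpa using (isHomogeneous_C σ (y i)).mul (isHomogeneous_X ℝ i)

lemma isHomogeneous_normSqPoly : (normSqPoly : MvPolynomial σ ℝ).IsHomogeneous 2 :=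
  IsHomogeneous.sum _ _ _ fun i _ => by simpa using (isHomogeneous_X ℝ i).pow 2

lemma isHomogeneous_zonal (lam : ℝ) (y : σ → ℝ) (n : ℕ) :
    (zonal lam y n).IsHomogeneous n := by
  induction n using Nat.twoStepInduction with
  | zero => exact isHomogeneous_one σ ℝ
  | one => exact zero_add 1 ▸ (isHomogeneous_C σ (2 * lam)).mul (isHomogeneous_dotPoly y)
  | more n ih0 ih1 =>
    rw [zonal]
    refine IsHomogeneous.sub ?_ ?_
    · have := (isHomogeneous_C σ (2 * ((n : ℝ) + 1 + lam) / ((n : ℝ) + 2))).mul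
        ((isHomogeneous_dotPoly y).mul ih1)
      rwa [show 0 + (1 + (n + 1)) = n + 2 by omega] at this
    · have := (isHomogeneous_C σ (((n : ℝ) + 2 * lam) / ((n : ℝ) + 2))).mul
        ((isHomogeneous_normSqPoly (σ := σ)).mul ih0)
      rwa [show 0 + (2 + n) = n + 2 by omega] at this

lemma dirDeriv_mul (y : σ → ℝ) (p q : MvPolynomial σ ℝ) :
    dirDeriv y (p * q) = p * dirDeriv y q + q * dirDeriv y p := by
  simp [Derivation.leibniz]

lemma dirDeriv_C (y : σ → ℝ) (r : ℝ) : dirDeriv y (C r) = 0 := by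
  simp only [dirDeriv_apply, pderiv_C, mul_zero, Finset.sum_const_zero]

lemma dirDeriv_C_mul (y : σ → ℝ) (r : ℝ) (q : MvPolynomial σ ℝ) :
    dirDeriv y (C r * q) = C r * dirDeriv y q := by
  rw [C_mul', C_mul', Derivation.map_smul]

/-- Supplies the cross term `2 * dirDeriv y p` of `laplacian_dotPoly_mul` in the proof of
harmonicity. -/
lemma dirDeriv_zonal_succ (lam : ℝ) (y : σ → ℝ) (hy : ∑ i, y i ^ 2 = 1) (n : ℕ) :
    dirDeriv y (zonal lam y (n + 1)) = C ((n : ℝ) + 2 * lam) * zonal lam y n := by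
  have h1 : dirDeriv y (dotPoly y) = 1 := by rw [dirDeriv_dotPoly, hy, C_1]
  induction n using Nat.twoStepInduction with
  | zero => simp only [zonal, dirDeriv_C_mul, h1, Nat.cast_zero, zero_add]
  | one =>
    simp only [zonal, map_sub, dirDeriv_C_mul, mul_one]
    simp only [dirDeriv_mul, dirDeriv_C, h1, dirDeriv_normSqPoly]
    have e : (C (2 * (((0 : ℕ) : ℝ) + 1 + lam) / (((0 : ℕ) : ℝ) + 2)) * (C (2 * lam) + C (2 * lam))
        - C ((((0 : ℕ) : ℝ) + 2 * lam) / (((0 : ℕ) : ℝ) + 2)) * C 2 : MvPolynomial σ ℝ)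
        = C (((1 : ℕ) : ℝ) + 2 * lam) * C (2 * lam) := by
      simp only [← C_add, ← C_mul, ← C_sub]
      congr 1
      push_cast
      ring
    rw [show (C 2 : MvPolynomial σ ℝ) = 2 from map_ofNat C 2] at e
    linear_combination dotPoly y * e
  | more n ih0 ih1 =>
    rw [zonal]
    simp only [map_sub, dirDeriv_C_mul]
    simp only [dirDeriv_mul, h1, dirDeriv_normSqPoly, ih0, ih1]
    -- Once `zonal lam y (n + 2)` is expanded, `e1` and `e2` express the vanishing of the
    -- coefficients of `dotPoly y * zonal lam y (n + 1)` and `normSqPoly * zonal lam y n`.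
    have e1 : (C (2 * (((n + 1 : ℕ) : ℝ) + 1 + lam) / (((n + 1 : ℕ) : ℝ) + 2))
        - C (((n + 2 : ℕ) : ℝ) + 2 * lam)) * C (2 * ((n : ℝ) + 1 + lam) / ((n : ℝ) + 2))
        + C (2 * (((n + 1 : ℕ) : ℝ) + 1 + lam) / (((n + 1 : ℕ) : ℝ) + 2))
          * C (((n + 1 : ℕ) : ℝ) + 2 * lam)
        - C ((((n + 1 : ℕ) : ℝ) + 2 * lam) / (((n + 1 : ℕ) : ℝ) + 2)) * C 2
        = (0 : MvPolynomial σ ℝ) := by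
      simp only [← C_add, ← C_mul, ← C_sub, ← C_0 (σ := σ)]
      congr 1
      push_cast
      field_simp
      ring
    have e2 : (C (2 * (((n + 1 : ℕ) : ℝ) + 1 + lam) / (((n + 1 : ℕ) : ℝ) + 2))
        - C (((n + 2 : ℕ) : ℝ) + 2 * lam)) * C (((n : ℝ) + 2 * lam) / ((n : ℝ) + 2))
        + C ((((n + 1 : ℕ) : ℝ) + 2 * lam) / (((n + 1 : ℕ) : ℝ) + 2)) * C ((n : ℝ) + 2 * lam)
        = (0 : MvPolynomial σ ℝ) := by
      simp only [← C_add, ← C_mul, ← C_sub, ← C_0 (σ := σ)]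
      congr 1
      push_cast
      field_simp
      ring
    rw [show (C 2 : MvPolynomial σ ℝ) = 2 from map_ofNat C 2] at e1
    rw [show zonal lam y (n + 2) = C (2 * ((n : ℝ) + 1 + lam) / ((n : ℝ) + 2))
      * (dotPoly y * zonal lam y (n + 1))
      - C (((n : ℝ) + 2 * lam) / ((n : ℝ) + 2)) * (normSqPoly * zonal lam y n) from rfl]
    linear_combination dotPoly y * zonal lam y (n + 1) * e1 - normSqPoly * zonal lam y n * e2

lemma laplacian_C_mul (r : ℝ) (q : MvPolynomial σ ℝ) :
    laplacian (C r * q) = C r * laplacian q := by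
  simp [C_mul']

/-- Both terms of the recurrence contribute a multiple of `zonal lam y n`; these cancel because the
dimension is `2 * lam + 2`. -/
lemma laplacian_zonal (lam : ℝ) (hlam : (Fintype.card σ : ℝ) = 2 * lam + 2) (y : σ → ℝ)
    (hy : ∑ i, y i ^ 2 = 1) (n : ℕ) : laplacian (zonal lam y n) = 0 := by
  induction n using Nat.twoStepInduction with
  | zero => simp [zonal, laplacian_apply]
  | one => simp only [zonal, laplacian_apply, pderiv_dotPoly, pderiv_C_mul, pderiv_C, mul_zero, Finset.sum_const_zero]
  | more n ih0 ih1 =>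
    rw [zonal, map_sub, laplacian_C_mul, laplacian_C_mul, laplacian_dotPoly_mul,
      laplacian_normSqPoly_mul (isHomogeneous_zonal lam y n), ih0, ih1,
      dirDeriv_zonal_succ lam y hy n, hlam]
    have e : C (2 * ((n : ℝ) + 1 + lam) / ((n : ℝ) + 2)) * (C 2 * C ((n : ℝ) + 2 * lam))
        - C (((n : ℝ) + 2 * lam) / ((n : ℝ) + 2)) * C (2 * (2 * lam + 2) + 4 * (n : ℝ))
        = (0 : MvPolynomial σ ℝ) := by
      simp only [← C_mul, ← C_sub, ← C_0 (σ := σ)]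
      congr 1
      field_simp
      ring
    rw [show (C 2 : MvPolynomial σ ℝ) = 2 from map_ofNat C 2] at e
    linear_combination zonal lam y n * e

/-- The leading coefficient of the Gegenbauer polynomials. -/
lemma exists_zonal_eq (lam : ℝ) (hlam : 0 < lam) (n : ℕ) :
    ∃ r : ℝ, 0 < r ∧ ∀ y : σ → ℝ, ∃ q : MvPolynomial σ ℝ,
      zonal lam y n = C r * dotPoly y ^ n + normSqPoly * q := by
  induction n using Nat.twoStepInduction with
  | zero => exact ⟨1, one_pos, fun y => ⟨0, by simp [zonal]⟩⟩
  | one => exact ⟨2 * lam, by positivity, fun y => ⟨0, by simp [zonal]⟩⟩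
  | more n ih0 ih1 =>
    obtain ⟨r, hr, h⟩ := ih1
    refine ⟨2 * ((n : ℝ) + 1 + lam) / ((n : ℝ) + 2) * r, by positivity, fun y => ?_⟩
    obtain ⟨q, hq⟩ := h y
    refine ⟨C (2 * ((n : ℝ) + 1 + lam) / ((n : ℝ) + 2)) * (dotPoly y * q)
      - C (((n : ℝ) + 2 * lam) / ((n : ℝ) + 2)) * zonal lam y n, ?_⟩
    rw [zonal, hq, C_mul]
    ring

lemma gegenbauer_form_nonneg (lam : ℝ) (hlam0 : 0 < lam)
    (hlam : (Fintype.card σ : ℝ) = 2 * lam + 2) (k : ℕ) {ι : Type*} [Fintype ι]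
    (y : ι → σ → ℝ) (hy : ∀ i, ∑ j, y i j ^ 2 = 1) (c : ι → ℝ) :
    0 ≤ ∑ i, ∑ j, c i * c j * (gegenbauer lam k).eval (∑ e, y i e * y j e) := by
  obtain ⟨r, hr, h⟩ := exists_zonal_eq (σ := σ) lam hlam0 k
  -- Only the left factor is split: its `normSqPoly` part is orthogonal to the harmonic right
  -- factor, and its power of `dotPoly` evaluates that factor at the pole.
  have key : ∀ i j, fischer (zonal lam (y i) k) (zonal lam (y j) k)
      = r * k.factorial * (gegenbauer lam k).eval (∑ e, y i e * y j e) := by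
    intro i j
    obtain ⟨q, hq⟩ := h (y i)
    conv_lhs => enter [1, 2]; rw [hq]
    rw [map_add, LinearMap.add_apply, fischer_normSqPoly_mul, laplacian_zonal lam hlam _ (hy j),
      map_zero, add_zero, C_mul', map_smul, LinearMap.smul_apply,
      fischer_dotPoly_pow _ _ _ (isHomogeneous_zonal lam (y j) k), eval_zonal _ _ _ (hy i),
      smul_eq_mul, mul_assoc]
    simp only [mul_comm (y j _)]
  have hpos := fischer_self_nonneg (∑ i, c i • zonal lam (y i) k)
  have hexp : fischer (∑ i, c i • zonal lam (y i) k) (∑ i, c i • zonal lam (y i) k)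
      = r * k.factorial
        * ∑ i, ∑ j, c i * c j * (gegenbauer lam k).eval (∑ e, y i e * y j e) := by
    simp only [map_sum, LinearMap.sum_apply, map_smul, LinearMap.smul_apply, key, smul_eq_mul,
      Finset.mul_sum]
    rw [Finset.sum_comm]
    exact Finset.sum_congr rfl fun i _ => Finset.sum_congr rfl fun j _ => by ring
  rw [hexp] at hpos
  exact nonneg_of_mul_nonneg_right hpos (by positivity)

end Fischer

end SphereKernel
namespace SphereKernel

/-! ### Kernels on spheres, their quadratic forms and strictness. -/

section Kernels

lemma inner_sph_eq_sum {m : ℕ} (x y : Sph m) :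
    inner ℝ (x : EuclideanSpace ℝ (Fin (m + 1))) (y : EuclideanSpace ℝ (Fin (m + 1)))
      = ∑ e, x.1 e * y.1 e := by
  simp [PiLp.inner_apply, mul_comm]

lemma sum_sq_sph {m : ℕ} (x : Sph m) : ∑ e, x.1 e ^ 2 = 1 := by
  have h := inner_sph_eq_sum x x
  rw [real_inner_self_eq_norm_sq, norm_eq_of_mem_sphere] at h
  simpa [sq] using h.symm

lemma inner_sph_mem_Icc {m : ℕ} (x y : Sph m) :
    inner ℝ (x : EuclideanSpace ℝ (Fin (m + 1))) (y : EuclideanSpace ℝ (Fin (m + 1)))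
      ∈ Set.Icc (-1 : ℝ) 1 := by
  have h := abs_real_inner_le_norm (x : EuclideanSpace ℝ (Fin (m + 1)))
    (y : EuclideanSpace ℝ (Fin (m + 1)))
  rw [norm_eq_of_mem_sphere, norm_eq_of_mem_sphere, mul_one] at h
  exact abs_le.mp h

lemma isoKernel_symm (m : ℕ) (g : ℝ → ℝ) (x y : Sph m) :
    isoKernel m g x y = isoKernel m g y x := by
  rw [isoKernel, isoKernel, real_inner_comm]

lemma form_isoKernel_P_nonneg {m : ℕ} (hm : 2 ≤ m) (l : ℕ) {ι : Type*} [Fintype ι]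
    (z : ι → Sph m) (c : ι → ℝ) :
    0 ≤ ∑ i, ∑ j, c i * c j * isoKernel m (fun t => (P m l).eval t) (z i) (z j) := by
  have hm' : (2 : ℝ) ≤ m := by exact_mod_cast hm
  have h := gegenbauer_form_nonneg (σ := Fin (m + 1)) (((m : ℝ) - 1) / 2) (by linarith)
    (by simp; ring) l (fun i e => (z i).1 e) (fun i => sum_sq_sph (z i)) c
  simpa only [isoKernel, P, if_neg (show m ≠ 1 by omega), inner_sph_eq_sum] using h

lemma exists_angle (x : Sph 1) : ∃ θ : ℝ, x.1 0 = Real.cos θ ∧ x.1 1 = Real.sin θ := by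
  have h := sum_sq_sph x
  rw [Fin.sum_univ_two] at h
  have hn : ‖(⟨x.1 0, x.1 1⟩ : ℂ)‖ = 1 := by
    rw [Complex.norm_eq_sqrt_sq_add_sq, h, Real.sqrt_one]
  refine ⟨Complex.arg ⟨x.1 0, x.1 1⟩, ?_, ?_⟩
  · have := Complex.norm_mul_cos_arg ⟨x.1 0, x.1 1⟩
    rw [hn, one_mul] at this
    exact this.symm
  · have := Complex.norm_mul_sin_arg ⟨x.1 0, x.1 1⟩
    rw [hn, one_mul] at this
    exact this.symm

/-- The circular kernels are sums of two squares. -/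
lemma exists_isoKernel_P_one_eq (k : ℕ) : ∃ u v : Sph 1 → ℝ, ∀ x y,
    isoKernel 1 (fun t => (P 1 k).eval t) x y = u x * u y + v x * v y := by
  rcases Nat.eq_zero_or_pos k with rfl | hk
  · exact ⟨fun _ => 1, fun _ => 0, fun x y => by simp [isoKernel, P]⟩
  choose θ hc hs using exists_angle
  refine ⟨fun x => √(2 / k) * Real.cos (k * θ x), fun x => √(2 / k) * Real.sin (k * θ x),
    fun x y => ?_⟩
  have hsq : √(2 / (k : ℝ)) * √(2 / (k : ℝ)) = 2 / k := Real.mul_self_sqrt (by positivity)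
  have hin : ∑ e, x.1 e * y.1 e = Real.cos (θ x - θ y) := by
    rw [Fin.sum_univ_two, hc, hc, hs, hs, Real.cos_sub]
  simp only [isoKernel, P, if_true, if_neg hk.ne', inner_sph_eq_sum, hin, Polynomial.eval_mul,
    Polynomial.eval_C, Polynomial.Chebyshev.T_real_cos]
  rw [Int.cast_natCast, mul_sub, Real.cos_sub]
  linear_combination -(Real.cos (k * θ x) * Real.cos (k * θ y)
    + Real.sin (k * θ x) * Real.sin (k * θ y)) * hsq

/-- A Schur product argument: the circular factor `u ⊗ u + v ⊗ v` is absorbed into the scalars,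
leaving two forms of `P_l`. -/
lemma form_prod_nonneg {m : ℕ} (hm : 2 ≤ m) (k l : ℕ) {ι : Type*} [Fintype ι]
    (x : ι → Sph 1) (z : ι → Sph m) (c : ι → ℝ) :
    0 ≤ ∑ i, ∑ j, c i * c j * (isoKernel 1 (fun t => (P 1 k).eval t) (x i) (x j)
      * isoKernel m (fun t => (P m l).eval t) (z i) (z j)) := by
  obtain ⟨u, v, huv⟩ := exists_isoKernel_P_one_eq k
  have h := add_nonneg (form_isoKernel_P_nonneg hm l z fun i => c i * u (x i))
    (form_isoKernel_P_nonneg hm l z fun i => c i * v (x i))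
  simp only [← Finset.sum_add_distrib] at h
  refine h.trans_eq (Finset.sum_congr rfl fun i _ => Finset.sum_congr rfl fun j _ => ?_)
  rw [huv]
  ring

/-- The kernels `P_l` have finite-dimensional feature maps on finite families. -/
lemma exists_isoKernel_P_factor {m : ℕ} (hm : 2 ≤ m) (l : ℕ) {ι : Type*} [Fintype ι]
    (z : ι → Sph m) : ∃ (N : ℕ) (v : Fin N → ι → ℝ), ∀ i j,
      isoKernel m (fun t => (P m l).eval t) (z i) (z j) = ∑ r, v r i * v r j := by
  set M : Matrix ι ι ℝ :=
    Matrix.of fun i j => isoKernel m (fun t => (P m l).eval t) (z i) (z j) with hM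
  have hpsd : M.PosSemidef := by
    refine Matrix.PosSemidef.of_dotProduct_mulVec_nonneg ?_ fun c => ?_
    · ext i j
      simp only [hM, Matrix.conjTranspose_apply, Matrix.of_apply, star_trivial]
      exact isoKernel_symm _ _ _ _
    · refine (form_isoKernel_P_nonneg hm l z c).trans_eq ?_
      simp only [dotProduct, Matrix.mulVec, hM, Matrix.of_apply, Finset.mul_sum, star_trivial]
      exact Finset.sum_congr rfl fun i _ => Finset.sum_congr rfl fun j _ => by ring
  obtain ⟨N, v, hv⟩ := Matrix.posSemidef_iff_eq_sum_vecMulVec.mp hpsd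
  refine ⟨N, v, fun i j => ?_⟩
  have := congrFun (congrFun hv i) j
  simpa [hM, Matrix.sum_apply, Matrix.vecMulVec_apply] using this

/-- The form of a kernel at a family of points that may repeat, grouped by points. -/
lemma form_eq_form_fiber {X ι : Type*} [Fintype ι] [DecidableEq X] (K : X → X → ℝ) (x : ι → X)
    (c : ι → ℝ) :
    ∑ i, ∑ j, c i * c j * K (x i) (x j)
      = ∑ ξ ∈ Finset.univ.image x, ∑ η ∈ Finset.univ.image x,
        (∑ i with x i = ξ, c i) * (∑ j with x j = η, c j) * K ξ η := by
  have hx : ∀ i ∈ (Finset.univ : Finset ι), x i ∈ Finset.univ.image x := fun i _ =>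
    Finset.mem_image_of_mem x (Finset.mem_univ i)
  rw [← Finset.sum_fiberwise_of_maps_to hx]
  refine Finset.sum_congr rfl fun ξ _ => ?_
  rw [Finset.sum_congr rfl fun i _ => (Finset.sum_fiberwise_of_maps_to hx _).symm,
    Finset.sum_comm]
  refine Finset.sum_congr rfl fun η _ => ?_
  rw [Finset.sum_mul_sum, Finset.sum_mul]
  refine Finset.sum_congr rfl fun i hi => ?_
  rw [Finset.sum_mul]
  refine Finset.sum_congr rfl fun j hj => ?_
  rw [(Finset.mem_filter.mp hi).2, (Finset.mem_filter.mp hj).2]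

lemma IsStrictPosDefKernel.form_pos_of_finset {X : Type*} {K : X → X → ℝ}
    (hK : IsStrictPosDefKernel K) (s : Finset X) (c : X → ℝ) {ξ : X} (hξ : ξ ∈ s)
    (hc : c ξ ≠ 0) : 0 < ∑ x ∈ s, ∑ y ∈ s, c x * c y * K x y := by
  let e := s.equivFin.symm
  have h := hK.2 s.card (fun i => (e i : X)) (Subtype.val_injective.comp e.injective)
    (fun i => c (e i)) (fun h0 => hc <| by
      have := congrFun h0 (e.symm ⟨ξ, hξ⟩)
      simpa using this)
  rw [← Finset.sum_coe_sort s]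
  simp only [← Finset.sum_coe_sort s (fun y => c _ * c y * K _ y)]
  rw [← e.sum_comp]
  simpa only [← e.sum_comp (fun y : s => c _ * c y * K _ y)] using h

/-- The definition covers distinct points only; first coordinates on the product may repeat, so
scalars are first added up over equal points. -/
lemma IsStrictPosDefKernel.form_nonneg {X : Type*} {K : X → X → ℝ}
    (hK : IsStrictPosDefKernel K) {ι : Type*} [Fintype ι] (x : ι → X) (c : ι → ℝ) :
    0 ≤ ∑ i, ∑ j, c i * c j * K (x i) (x j) := by
  classical
  rw [form_eq_form_fiber]
  by_cases h : ∃ ξ ∈ Finset.univ.image x, ∑ i with x i = ξ, c i ≠ 0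
  · obtain ⟨ξ, hξ, h0⟩ := h
    exact (hK.form_pos_of_finset _ (fun ξ => ∑ i with x i = ξ, c i) hξ h0).le
  · push Not at h
    refine (Finset.sum_eq_zero fun ξ hξ => Finset.sum_eq_zero fun η _ => ?_).ge
    rw [h ξ hξ, zero_mul, zero_mul]

/-- The form taken by strictness when points repeat: only the total scalar at each point is forced
to vanish. -/
lemma IsStrictPosDefKernel.sum_fiber_eq_zero {X : Type*} [DecidableEq X] {K : X → X → ℝ}
    (hK : IsStrictPosDefKernel K) {ι : Type*} [Fintype ι] (x : ι → X) (c : ι → ℝ)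
    (h : ∑ i, ∑ j, c i * c j * K (x i) (x j) = 0) (ξ : X) : ∑ i with x i = ξ, c i = 0 := by
  by_contra h0
  have hξ : ξ ∈ Finset.univ.image x := by
    by_contra hn
    refine h0 (Finset.sum_eq_zero fun i hi => absurd ?_ hn)
    exact (Finset.mem_filter.mp hi).2 ▸ Finset.mem_image_of_mem x (Finset.mem_univ i)
  rw [form_eq_form_fiber] at h
  exact (hK.form_pos_of_finset _ (fun ξ => ∑ i with x i = ξ, c i) hξ h0).ne' h

/-- If the forms of all `P_k` with `b_k > 0` vanish, so does the form of `∑ b_k P_k`, with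
arbitrary weights `w` on the pairs. -/
lemma IsSchoenbergSeries.form_eq_zero {m : ℕ} {g : ℝ → ℝ} {b : ℕ → ℝ}
    (hg : IsSchoenbergSeries m g b) {ι : Type*} [Fintype ι] (x : ι → Sph m) (w : ι → ι → ℝ)
    (h : ∀ k, 0 < b k →
      ∑ i, ∑ j, w i j * isoKernel m (fun t => (P m k).eval t) (x i) (x j) = 0) :
    ∑ i, ∑ j, w i j * isoKernel m g (x i) (x j) = 0 := by
  have hs : HasSum (fun k => ∑ i, ∑ j, w i j *
      (b k * isoKernel m (fun t => (P m k).eval t) (x i) (x j)))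
      (∑ i, ∑ j, w i j * isoKernel m g (x i) (x j)) :=
    hasSum_sum fun i _ => hasSum_sum fun j _ =>
      (hg.2.2 _ (inner_sph_mem_Icc (x i) (x j))).mul_left _
  refine hs.unique ?_
  convert hasSum_zero using 2 with k
  have e : ∑ i, ∑ j, w i j * (b k * isoKernel m (fun t => (P m k).eval t) (x i) (x j))
      = b k * ∑ i, ∑ j, w i j * isoKernel m (fun t => (P m k).eval t) (x i) (x j) := by
    simp only [Finset.mul_sum]
    exact Finset.sum_congr rfl fun i _ => Finset.sum_congr rfl fun j _ => by ring
  rw [e]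
  rcases (hg.1 k).eq_or_lt with h0 | h0
  · rw [← h0, zero_mul]
  · rw [h k h0, mul_zero]

lemma hasSum_form_isoKernelProd {m M : ℕ} {f : ℝ → ℝ → ℝ} {a : ℕ → ℕ → ℝ}
    (hf : IsDoubleSchoenbergSeries m M f a) {ι : Type*} [Fintype ι] (p : ι → Sph m × Sph M)
    (c : ι → ℝ) :
    HasSum (fun q : ℕ × ℕ => a q.1 q.2 * ∑ i, ∑ j, c i * c j *
      (isoKernel m (fun t => (P m q.1).eval t) (p i).1 (p j).1
        * isoKernel M (fun t => (P M q.2).eval t) (p i).2 (p j).2))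
      (∑ i, ∑ j, c i * c j * isoKernelProd m M f (p i) (p j)) := by
  have e : (fun q : ℕ × ℕ => a q.1 q.2 * ∑ i, ∑ j, c i * c j *
      (isoKernel m (fun t => (P m q.1).eval t) (p i).1 (p j).1
        * isoKernel M (fun t => (P M q.2).eval t) (p i).2 (p j).2))
      = fun q : ℕ × ℕ => ∑ i, ∑ j, c i * c j *
        (a q.1 q.2 * isoKernel m (fun t => (P m q.1).eval t) (p i).1 (p j).1
          * isoKernel M (fun t => (P M q.2).eval t) (p i).2 (p j).2) := by
    funext q
    simp only [Finset.mul_sum]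
    exact Finset.sum_congr rfl fun i _ => Finset.sum_congr rfl fun j _ => by ring
  rw [e]
  exact hasSum_sum fun i _ => hasSum_sum fun j _ =>
    (hf.2.2 _ (inner_sph_mem_Icc (p i).1 (p j).1) _
      (inner_sph_mem_Icc (p i).2 (p j).2)).mul_left (c i * c j)

/-- If the form of `P_k ⊗ P_l` vanishes for all `k` in a set of `SPD 1`, then the form of `P_l`
vanishes on every fibre over a point of the circle. -/
lemma fiber_form_eq_zero {m : ℕ} (hm : 2 ≤ m) (l : ℕ) {I : Set ℕ} (hI : I ∈ SPD 1)
    {ι : Type*} [Fintype ι] [DecidableEq (Sph 1)] (x : ι → Sph 1) (z : ι → Sph m) (c : ι → ℝ)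
    (h : ∀ k ∈ I, ∑ i, ∑ j, c i * c j * (isoKernel 1 (fun t => (P 1 k).eval t) (x i) (x j)
      * isoKernel m (fun t => (P m l).eval t) (z i) (z j)) = 0) (ξ : Sph 1) :
    ∑ i with x i = ξ, ∑ j with x j = ξ,
      c i * c j * isoKernel m (fun t => (P m l).eval t) (z i) (z j) = 0 := by
  obtain ⟨g, b, -, hg, hspd, rfl⟩ := hI
  obtain ⟨N, v, hv⟩ := exists_isoKernel_P_factor hm l z
  have h0 := hg.form_eq_zero x
    (fun i j => c i * c j * isoKernel m (fun t => (P m l).eval t) (z i) (z j)) fun k hk => by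
      rw [← h k hk]
      exact Finset.sum_congr rfl fun i _ => Finset.sum_congr rfl fun j _ => by ring
  -- The `P_l` weights split into features, so the vanishing sum becomes a sum of nonnegative forms
  -- of `g`, each of which must vanish.
  have h1 : ∑ r, ∑ i, ∑ j, c i * v r i * (c j * v r j) * isoKernel 1 g (x i) (x j) = 0 := by
    refine Eq.trans ?_ h0
    rw [Finset.sum_comm]
    refine Finset.sum_congr rfl fun i _ => ?_
    rw [Finset.sum_comm]
    refine Finset.sum_congr rfl fun j _ => ?_
    rw [hv, Finset.mul_sum, Finset.sum_mul]
    exact Finset.sum_congr rfl fun r _ => by ring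
  have h2 : ∀ r ∈ Finset.univ,
      ∑ i, ∑ j, c i * v r i * (c j * v r j) * isoKernel 1 g (x i) (x j) = 0 :=
    (Finset.sum_eq_zero_iff_of_nonneg fun r _ =>
      hspd.form_nonneg x fun i => c i * v r i).mp h1
  have h3 : ∀ r, ∑ i with x i = ξ, c i * v r i = 0 := fun r =>
    hspd.sum_fiber_eq_zero x _ (h2 r (Finset.mem_univ r)) ξ
  -- Squaring and summing over the features recovers the `P_l` form on the fibre.
  have h4 : ∑ r, (∑ i with x i = ξ, c i * v r i) * (∑ i with x i = ξ, c i * v r i) = 0 :=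
    Finset.sum_eq_zero fun r _ => by rw [h3, zero_mul]
  refine Eq.trans ?_ h4
  symm
  simp only [Finset.sum_mul_sum]
  rw [Finset.sum_comm]
  refine Finset.sum_congr rfl fun i _ => ?_
  rw [Finset.sum_comm]
  refine Finset.sum_congr rfl fun j _ => ?_
  rw [hv, Finset.mul_sum]
  exact Finset.sum_congr rfl fun r _ => by ring

/-- A family on a product that is determined by its second coordinates on the fibres of the first
has zero coefficients as soon as the fibre forms of all `P_l` in a set of `SPD m` vanish. -/
lemma eq_zero_of_fiber_form_eq_zero {m : ℕ} {J : Set ℕ} (hJ : J ∈ SPD m) {ι : Type*}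
    (s : Finset ι) (z : ι → Sph m) (hz : Set.InjOn z s) (c : ι → ℝ)
    (h : ∀ l ∈ J, ∑ i ∈ s, ∑ j ∈ s,
      c i * c j * isoKernel m (fun t => (P m l).eval t) (z i) (z j) = 0) {i₀ : ι} (hi₀ : i₀ ∈ s) :
    c i₀ = 0 := by
  classical
  obtain ⟨g, b, -, hg, hspd, rfl⟩ := hJ
  have hform := hg.form_eq_zero (fun i : s => z i) (fun i j => c i * c j) fun l hl => by
    rw [← h l hl, ← Finset.sum_coe_sort s]
    exact Finset.sum_congr rfl fun i _ => Finset.sum_coe_sort s fun j => c i * c j *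
      isoKernel m (fun t => (P m l).eval t) (z i) (z j)
  have hlast := hspd.sum_fiber_eq_zero (fun i : s => z i) (fun i => c i) hform (z i₀)
  rwa [Finset.sum_eq_single (⟨i₀, hi₀⟩ : s)] at hlast
  · intro i hi hne
    exact absurd (Subtype.ext (hz i.2 hi₀ (Finset.mem_filter.mp hi).2)) hne
  · intro hn
    exact absurd (by simp) hn

/-- If the form of the product kernel vanishes, so do the forms of all `P_k ⊗ P_l` that occur in
its series. -/
lemma form_prod_eq_zero {m : ℕ} (hm : 2 ≤ m) {f : ℝ → ℝ → ℝ} {a : ℕ → ℕ → ℝ}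
    (hf : IsDoubleSchoenbergSeries 1 m f a) {ι : Type*} [Fintype ι] (p : ι → Sph 1 × Sph m)
    (c : ι → ℝ) (h : ∑ i, ∑ j, c i * c j * isoKernelProd 1 m f (p i) (p j) = 0) {k l : ℕ}
    (hkl : 0 < a k l) :
    ∑ i, ∑ j, c i * c j * (isoKernel 1 (fun t => (P 1 k).eval t) (p i).1 (p j).1
      * isoKernel m (fun t => (P m l).eval t) (p i).2 (p j).2) = 0 := by
  have hsum := hasSum_form_isoKernelProd hf p c
  have hterm := fun k l : ℕ => form_prod_nonneg hm k l (fun i => (p i).1) (fun i => (p i).2) c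
  generalize hF : (fun k l : ℕ => ∑ i, ∑ j, c i * c j *
    (isoKernel 1 (fun t => (P 1 k).eval t) (p i).1 (p j).1
      * isoKernel m (fun t => (P m l).eval t) (p i).2 (p j).2)) = F at *
  replace hsum : HasSum (fun q : ℕ × ℕ => a q.1 q.2 * F q.1 q.2) 0 := by
    rw [← h, ← hF]
    exact hsum
  replace hterm : ∀ k l, 0 ≤ F k l := by
    rw [← hF]
    exact hterm
  have h0 := (hasSum_zero_iff_of_nonneg fun q : ℕ × ℕ =>
    mul_nonneg (hf.1 q.1 q.2) (hterm q.1 q.2)).mp hsum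
  have h1 : F k l = 0 := (mul_eq_zero.mp (congrFun h0 (k, l))).resolve_left hkl.ne'
  rw [← hF] at h1
  exact h1

end Kernels

end SphereKernel

theorem theorem2p5 (m : ℕ) (hm : 2 ≤ m) (f : ℝ → ℝ → ℝ) (a : ℕ → ℕ → ℝ)
    (hcont : ContinuousOn (fun p : ℝ × ℝ => f p.1 p.2)
      (Set.Icc (-1 : ℝ) 1 ×ˢ Set.Icc (-1 : ℝ) 1))
    (hpos : SphereKernel.IsPosDefKernel (SphereKernel.isoKernelProd 1 m f))
    (hseries : SphereKernel.IsDoubleSchoenbergSeries 1 m f a)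
    (hJ : {l : ℕ | {k : ℕ | 0 < a k l} ∈ SphereKernel.SPD 1} ∈ SphereKernel.SPD m) :
    SphereKernel.IsStrictPosDefKernel (SphereKernel.isoKernelProd 1 m f) := by
  classical
  refine ⟨hpos, fun n p hp c hc => lt_of_le_of_ne (hpos.2 n p hp c) fun hzero => hc ?_⟩
  funext i₀
  -- Distinct points with the same first coordinate differ in the second.
  have hinj : Set.InjOn (fun i => (p i).2)
      (({i | (p i).1 = (p i₀).1} : Finset (Fin n)) : Set (Fin n)) := by
    intro i hi j hj hij
    have hi' : (p i).1 = (p i₀).1 := by simpa using hi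
    have hj' : (p j).1 = (p i₀).1 := by simpa using hj
    exact hp (Prod.ext (hi'.trans hj'.symm) hij)
  refine SphereKernel.eq_zero_of_fiber_form_eq_zero hJ _ _ hinj c (fun l hl => ?_) ?_
  · refine SphereKernel.fiber_form_eq_zero hm l hl (fun i => (p i).1) (fun i => (p i).2) c
      (fun k hk => ?_) _
    exact SphereKernel.form_prod_eq_zero hm hseries p c hzero.symm hk
  · exact Finset.mem_filter.mpr ⟨Finset.mem_univ _, rfl⟩
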